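/- Let $L$ be a loop transfer function and $S=\frac1{1+L}$ its sensitivity function. Let $(p_j)_{j\ge1}$ be an infinite sequence of distinct points (the open-loop poles) in the open right half-plane without limit point in $\mathbb C$, and let $d_j>0$ be real numbers (their orders, not necessarily integers). Suppose that on $\{\Re s\ge 0\}$, outside the zeros of the right-hand side, $S$ has the Weierstrass-type factorization $$S(s)=g(s)\prod_{j=1}^\infty (s-p_j)^{d_j}e^{q_j(s)},$$ where $g$ is holomorphic in a neighbourhood of $\{\Re s\ge0\}$ and has no zeros in $\{\Re s>0\}$, the $q_j$ are polynomials (convergence factors), the powers are principal (cuts along the horizontal half-lines from $p_j$ to the left), and the product converges locally uniformly on $\{\Re s\ge0\}$ to a limit that vanishes there only at the points $p_j$. For all sufficiently large $R$ let $\log_R S$ be a branch of $\log S$ on the half-disc $\{\Re s\ge 0,\ |s|\le R\}$ with horizontal cuts to the left from finitely many poles, among them all those with $|p_j|\le R$; that is, $e^{\log_R S}=S$ and $\log_R S(s)=h_R(s)+\sum_{j\in F_R}d_j\operatorname{Log}(s-p_j)$ outside the zeros of $S$, where $F_R$ is a finite set containing all $j$ with $|p_j|\le R$, and $h_R$ is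 holomorphic in the open half-disc and continuous on the closed half-disc outside the zeros of $g$. Assume that $\int_{\gamma_R}\log_R S(s)\,ds\to0$ as $R\to\infty$, where $\gamma_R$ is the semicircle $|s|=R$, $\Re s\ge0$. Then the Bode integral equals $4\pi\sum_j d_j\Re(p_j)$. Precisely: $\log|S(i\omega)|^2$ is integrable on every bounded interval, and $$\lim_{R\to\infty}\int_{-R}^{R}\log|S(i\omega)|^2\,d\omega=4\pi\sum_{j=1}^\infty d_j\,\Re(p_j)$$ in $[0,\infty]$. Moreover, $\omega\mapsto\log_R S(i\omega)$ is integrable on $[-R,R]$ for large $R$, the imaginary part of $2\int_{-R}^{R}\log_R S(i\omega)\,d\omega$ tends to $0$, and if the sum is finite, then $2\int_{-R}^{R}\log_R S(i\omega)\,d\omega\to4\pi\sum_j d_j\Re(p_j)$. Finally, if $\log|S(i\omega)|^2$ is integrable on $\mathbb R$, then the sum is finite and $\int_{-\infty}^{\infty}\log|S(i\omega)|^2\,d\omega=4\pi\sum_jd_j\Re(p_j)$. -/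

import Mathlib

open Complex Filter Topology

noncomputable section

/-- The sensitivity function `S = 1 / (1 + L)` of the unity feedback loop with loop transfer
function `L` (plant times controller). -/
def sensitivity (L : ℂ → ℂ) (s : ℂ) : ℂ := 1 / (1 + L s)

/-- The closed right half-plane. -/
def closedRHP : Set ℂ := {s | 0 ≤ s.re}

/-- The open right half-plane. -/
def openRHP : Set ℂ := {s | 0 < s.re}

/-- The points where a sensitivity function `g * ∏ (s - p j) ^ d j` vanishes: the open-loop poles
`p j`, and the zeros of `g` (inside the closed right half-plane the latter can only lie on the
imaginary axis). -/
def singularSet (g : ℂ → ℂ) (p : ℕ → ℂ) : Set ℂ := Set.range p ∪ {s | g s = 0}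

/-- The Weierstrass-type factorization `S = g * ∏ (s - p j) ^ d j` on the closed right half-plane.
As in the Weierstrass factorization theorem, every factor carries a convergence factor
`exp (q j s)` with a polynomial `q j`.  The powers are principal, so that `(s - p j) ^ d j` has its
cut along the horizontal half-line going from `p j` to the left.  Convergence of the product has
its classical meaning: the limit does not vanish unless a factor does. -/
structure WeierstrassFactorization (S g : ℂ → ℂ) (p : ℕ → ℂ) (d : ℕ → ℝ) : Prop where
  analytic : AnalyticOnNhd ℂ g closedRHP
  ne_zero : ∀ s ∈ openRHP, g s ≠ 0
  factor : ∃ (q : ℕ → Polynomial ℂ) (T : ℂ → ℂ),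
    TendstoLocallyUniformlyOn
      (fun (N : ℕ) (s : ℂ) =>
        ∏ j ∈ Finset.range N, ((s - p j) ^ (d j : ℂ) * Complex.exp ((q j).eval s)))
      T atTop closedRHP ∧
    (∀ s ∈ closedRHP, s ∉ Set.range p → T s ≠ 0) ∧
    (∀ s ∈ closedRHP, s ∉ singularSet g p → S s = g s * T s)

/-- `l` is a branch of `log S` for the contour consisting of the segment from `-iR` to `iR` and the
right semicircle of radius `R`, with horizontal branch cuts running from finitely many poles
`p j`, `j ∈ F`, to the left; `F` contains all the poles enclosed by the contour.  That is,
`exp l = S`, and `l = h + ∑ j ∈ F, d j * log (s - p j)`, with the principal logarithm and with `h`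
holomorphic in the half-disc and continuous up to its boundary (away from the zeros of `g`). -/
def IsLogBranch (S g : ℂ → ℂ) (p : ℕ → ℂ) (d : ℕ → ℝ) (R : ℝ) (l : ℂ → ℂ) : Prop :=
  ∃ (F : Finset ℕ) (h : ℂ → ℂ),
    (∀ j, ‖p j‖ ≤ R → j ∈ F) ∧
    DifferentiableOn ℂ h {s | s ∈ openRHP ∧ ‖s‖ < R} ∧
    ContinuousOn h {s | s ∈ closedRHP ∧ ‖s‖ ≤ R ∧ g s ≠ 0} ∧
    ∀ s ∈ closedRHP, ‖s‖ ≤ R → s ∉ singularSet g p →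
      l s = h s + ∑ j ∈ F, (d j : ℂ) * Complex.log (s - p j) ∧ Complex.exp (l s) = S s

/-- The contour integral of `f` along the semicircle `s = R e ^ (iθ)`, `-π/2 ≤ θ ≤ π/2`. -/
def arcIntegral (f : ℂ → ℂ) (R : ℝ) : ℂ :=
  ∫ θ in (-(Real.pi / 2))..(Real.pi / 2),
    f (R * Complex.exp (θ * I)) * (R * Complex.exp (θ * I) * I)

/-- The Bode integrand `log |S(iω)|²`. -/
def bodeIntegrand (S : ℂ → ℂ) (ω : ℝ) : ℝ := Real.log (‖S (I * ω)‖ ^ 2)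

/-- The Bode integral `2 ∫ log S(iω) dω` truncated to `[-R, R]`, for the branch `l` of `log S`. -/
def truncatedBodeLog (l : ℂ → ℂ) (R : ℝ) : ℂ := 2 * ∫ ω in (-R)..R, l (I * (ω : ℂ))

end

/-!
The proof integrates the branch `l` of `log S` over the boundary of the right half-disc of radius
`R`, where `l = h + ∑ j ∈ F, d j * log (s - p j)`.

Each logarithm is integrated by its antiderivative: `exists_hasContourIntegral_log` says that the
contour integral of `log (s - p)` is `-2πi` times the length of the part of the horizontal cut that
lies inside the half-disc. This length is `re p` for an enclosed pole. The set `F` may contain poles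
outside the half-disc as well; for these only the bounds `0 ≤ len ≤ re p` matter.

The regular part `h` contributes nothing (`hasContourIntegral_regular_part`), but it is singular at
the zeros of `g` on the imaginary axis. There the infinite product differs from a partial product
by a factor close to `1`, and the cuts of the finitely many factors split a neighbourhood into two
convex pieces. On each of them, `h` minus explicit logarithms is a continuous function whose
exponential stays near a nonzero constant, hence is bounded (`exists_norm_le_of_exp_near_const`).
So `h` is `m * log (s - z)` up to a bounded function (`exists_local_bound`); the logarithms, whose
cuts do not enter the half-disc, integrate to zero, and Cauchy's theorem applies to the bounded
remainder (`hasContourIntegral_zero_of_bounded`).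

Consequently `2 ∫ l(iω) dω` over `[-R, R]` equals `4π c(R)` minus `2i` times the integral over the
arc, where the real number `c(R) = ∑ j ∈ F, d j * len j` lies between the sum of `d j * re (p j)`
over the enclosed poles and the sum over all poles. Hence `c(R)` tends to the full sum, finite or
not, and taking real and imaginary parts gives all the claims.
-/

/-! ### Integrals of the logarithm along curves -/

/-- The antiderivative `z * log z - z` of the principal logarithm extends continuously to `0`. -/
theorem continuousAt_mul_log_sub_self {z : ℂ} (hz : z ∈ slitPlane ∨ z = 0) :
    ContinuousAt (fun w : ℂ => w * log w - w) z := by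
  rcases hz with hz | rfl
  · exact (continuousAt_id.mul (continuousAt_clog hz)).sub continuousAt_id
  · refine ContinuousAt.sub ?_ continuousAt_id
    have hb : ∀ w : ℂ, ‖w * log w‖ ≤ |‖w‖ * Real.log ‖w‖| + ‖w‖ * Real.pi := by
      intro w
      rw [norm_mul, abs_mul, abs_of_nonneg (norm_nonneg w), ← mul_add]
      refine mul_le_mul_of_nonneg_left ?_ (norm_nonneg w)
      refine (norm_le_abs_re_add_abs_im _).trans ?_
      rw [log_re, log_im]
      exact add_le_add_right (abs_arg_le_pi w) _
    have hc : Continuous fun w : ℂ => |‖w‖ * Real.log ‖w‖| + ‖w‖ * Real.pi :=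
      (Real.continuous_mul_log.comp continuous_norm).abs.add (continuous_norm.mul_const _)
    have h0 : Tendsto (fun w : ℂ => |‖w‖ * Real.log ‖w‖| + ‖w‖ * Real.pi) (𝓝 0) (𝓝 0) := by
      simpa using hc.tendsto 0
    simpa [ContinuousAt] using squeeze_zero_norm hb h0

theorem hasDerivAt_mul_log_sub_self {z : ℂ} (hz : z ∈ slitPlane) :
    HasDerivAt (fun w : ℂ => w * log w - w) (log z) z := by
  have h : HasDerivAt (fun w : ℂ => w * log w - w) (1 * log z + z * z⁻¹ - 1) z :=
    ((hasDerivAt_id z).mul (hasDerivAt_log hz)).sub (hasDerivAt_id z)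
  rwa [mul_inv_cancel₀ (slitPlane_ne_zero hz), one_mul, add_sub_cancel_right] at h

theorem intervalIntegrable_log_comp {γ : ℝ → ℂ} (hγ : ∀ t, AnalyticAt ℝ γ t) (a b : ℝ) :
    IntervalIntegrable (fun t => log (γ t)) MeasureTheory.volume a b := by
  have hc : Continuous γ := continuous_iff_continuousAt.2 fun t => (hγ t).continuousAt
  have h1 : IntervalIntegrable (fun t => Real.log ‖γ t‖) MeasureTheory.volume a b :=
    MeromorphicOn.intervalIntegrable_log_norm fun t _ => (hγ t).meromorphicAt
  have h2 : IntervalIntegrable (fun t => (γ t).arg) MeasureTheory.volume a b := by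
    refine (intervalIntegrable_const (c := Real.pi)).mono_fun
      (measurable_arg.comp hc.measurable).aestronglyMeasurable ?_
    refine Eventually.of_forall fun t => ?_
    rw [Real.norm_of_nonneg Real.pi_pos.le]
    exact abs_arg_le_pi _
  have h1' : IntervalIntegrable (fun t => (Real.log ‖γ t‖ : ℂ)) MeasureTheory.volume a b :=
    ⟨h1.1.ofReal, h1.2.ofReal⟩
  have h2' : IntervalIntegrable (fun t => ((γ t).arg : ℂ)) MeasureTheory.volume a b :=
    ⟨h2.1.ofReal, h2.2.ofReal⟩
  exact h1'.add (h2'.mul_const I)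

/-- Along a curve avoiding the branch cut, `log` is integrated by its antiderivative; the curve may
pass through the logarithmic singularity at countably many times. -/
theorem integral_log_mul_deriv {γ γ' : ℝ → ℂ} {a b : ℝ} (hab : a ≤ b) {s : Set ℝ}
    (hs : s.Countable) (hd : ∀ t, HasDerivAt γ (γ' t) t)
    (hγ : ∀ t ∈ Set.Icc a b, γ t ∈ slitPlane ∨ γ t = 0)
    (h0 : ∀ t ∈ Set.Ioo a b \ s, γ t ≠ 0)
    (hi : IntervalIntegrable (fun t => log (γ t) * γ' t) MeasureTheory.volume a b) :
    ∫ t in a..b, log (γ t) * γ' t =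
      (γ b * log (γ b) - γ b) - (γ a * log (γ a) - γ a) := by
  refine MeasureTheory.integral_eq_of_hasDerivAt_off_countable_of_le
    (fun t => γ t * log (γ t) - γ t) _ hab hs ?_ ?_ hi
  · intro t ht
    exact (ContinuousAt.comp (f := γ) (continuousAt_mul_log_sub_self (hγ t ht))
      (hd t).continuousAt).continuousWithinAt
  · intro t ht
    have hz : γ t ∈ slitPlane :=
      (hγ t (Set.Ioo_subset_Icc_self ht.1)).resolve_right (h0 t ht)
    exact HasDerivAt.comp t (hasDerivAt_mul_log_sub_self hz) (hd t)

theorem log_eq_log_neg_add {z : ℂ} (hz : 0 < z.im) : log z = log (-z) + Real.pi * I := by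
  rw [log, log, norm_neg, arg_neg_eq_arg_sub_pi_of_im_pos hz]
  push_cast; ring

theorem log_eq_log_neg_sub {z : ℂ} (hz : z.im < 0) : log z = log (-z) - Real.pi * I := by
  rw [log, log, norm_neg, arg_neg_eq_arg_add_pi_of_im_neg hz]
  push_cast; ring

/-- Turning the branch cut from the left to the right: along a curve that crosses the horizontal
line through `0` once, from below, the integrals of the two branches differ by a boundary term. -/
theorem integral_log_mul_deriv_of_crossing {γ γ' : ℝ → ℂ} {a b c : ℝ} (hc : c ∈ Set.Icc a b)
    (hd : ∀ t, HasDerivAt γ (γ' t) t) (hγ' : Continuous γ')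
    (hlt : ∀ t ∈ Set.Ico a c, (γ t).im < 0) (hgt : ∀ t ∈ Set.Ioc c b, 0 < (γ t).im)
    (hi : ∀ x y, IntervalIntegrable (fun t => log (-γ t) * γ' t) MeasureTheory.volume x y) :
    ∫ t in a..b, log (γ t) * γ' t =
      (∫ t in a..b, log (-γ t) * γ' t) + Real.pi * I * (γ b + γ a - 2 * γ c) := by
  have hi' : ∀ x y, IntervalIntegrable (fun t => (Real.pi * I : ℂ) * γ' t)
      MeasureTheory.volume x y := fun x y => (hγ'.const_mul _).intervalIntegrable x y
  have hf : ∀ x y, ∫ t in x..y, γ' t = γ y - γ x := fun x y =>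
    intervalIntegral.integral_eq_sub_of_hasDerivAt (fun t _ => hd t) (hγ'.intervalIntegrable x y)
  have e1 : Set.EqOn (fun t => log (γ t) * γ' t)
      (fun t => log (-γ t) * γ' t - Real.pi * I * γ' t) (Set.uIoo a c) := by
    intro t ht
    rw [Set.uIoo_of_le hc.1] at ht
    simp only [log_eq_log_neg_sub (hlt t ⟨ht.1.le, ht.2⟩)]
    ring
  have e2 : Set.EqOn (fun t => log (γ t) * γ' t)
      (fun t => log (-γ t) * γ' t + Real.pi * I * γ' t) (Set.uIoo c b) := by
    intro t ht
    rw [Set.uIoo_of_le hc.2] at ht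
    simp only [log_eq_log_neg_add (hgt t ⟨ht.1, ht.2.le⟩)]
    ring
  have i1 : IntervalIntegrable (fun t => log (γ t) * γ' t) MeasureTheory.volume a c :=
    ((hi a c).sub (hi' a c)).congr_uIoo e1.symm
  have i2 : IntervalIntegrable (fun t => log (γ t) * γ' t) MeasureTheory.volume c b :=
    ((hi c b).add (hi' c b)).congr_uIoo e2.symm
  rw [← intervalIntegral.integral_add_adjacent_intervals i1 i2,
    ← intervalIntegral.integral_add_adjacent_intervals (hi a c) (hi c b),
    intervalIntegral.integral_congr_uIoo e1, intervalIntegral.integral_congr_uIoo e2,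
    intervalIntegral.integral_sub (hi a c) (hi' a c),
    intervalIntegral.integral_add (hi c b) (hi' c b),
    intervalIntegral.integral_const_mul, intervalIntegral.integral_const_mul, hf, hf]
  ring

/-! ### Contour integrals over the boundary of the half-disc -/

/-- The closed right half-disc of radius `R` around `0`. -/
def halfDisc (R : ℝ) : Set ℂ := {s | 0 ≤ s.re ∧ ‖s‖ ≤ R}

/-- `f` is integrable on the boundary of the right half-disc of radius `R`, on the semicircle as
well as on the segment of the imaginary axis, and its contour integral, counterclockwise, is `v`. -/
def HasContourIntegral (R : ℝ) (f : ℂ → ℂ) (v : ℂ) : Prop :=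
  IntervalIntegrable (fun ω : ℝ => f (I * ω)) MeasureTheory.volume (-R) R ∧
  IntervalIntegrable (fun θ : ℝ => f (R * exp (θ * I)) * (R * exp (θ * I) * I))
    MeasureTheory.volume (-(Real.pi / 2)) (Real.pi / 2) ∧
  arcIntegral f R - I * ∫ ω in (-R)..R, f (I * ω) = v

namespace HasContourIntegral

variable {R : ℝ} {f f₁ f₂ : ℂ → ℂ} {v v₁ v₂ : ℂ}

theorem zero : HasContourIntegral R (fun _ => 0) 0 := by
  refine ⟨by simp, by simp, by simp [arcIntegral]⟩

theorem add (h₁ : HasContourIntegral R f₁ v₁) (h₂ : HasContourIntegral R f₂ v₂) :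
    HasContourIntegral R (fun s => f₁ s + f₂ s) (v₁ + v₂) := by
  refine ⟨h₁.1.add h₂.1, ?_, ?_⟩
  · simpa only [add_mul] using h₁.2.1.add h₂.2.1
  · rw [← h₁.2.2, ← h₂.2.2, arcIntegral, arcIntegral, arcIntegral]
    simp only [add_mul]
    rw [intervalIntegral.integral_add h₁.2.1 h₂.2.1, intervalIntegral.integral_add h₁.1 h₂.1]
    ring

theorem const_mul (c : ℂ) (h : HasContourIntegral R f v) :
    HasContourIntegral R (fun s => c * f s) (c * v) := by
  refine ⟨h.1.const_mul c, ?_, ?_⟩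
  · simpa only [mul_assoc] using h.2.1.const_mul c
  · rw [← h.2.2, arcIntegral, arcIntegral]
    simp only [mul_assoc c]
    rw [intervalIntegral.integral_const_mul, intervalIntegral.integral_const_mul]
    ring

theorem sum {ι : Type*} (F : Finset ι) {φ : ι → ℂ → ℂ} {w : ι → ℂ}
    (h : ∀ j ∈ F, HasContourIntegral R (φ j) (w j)) :
    HasContourIntegral R (fun s => ∑ j ∈ F, φ j s) (∑ j ∈ F, w j) := by
  classical
  induction F using Finset.induction_on with
  | empty => simpa using zero
  | insert a F ha ih =>
    simp only [Finset.sum_insert ha]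
    exact (h a (Finset.mem_insert_self a F)).add
      (ih fun j hj => h j (Finset.mem_insert_of_mem hj))

end HasContourIntegral

theorem I_mul_mem_halfDisc {R ω : ℝ} (hω : ω ∈ Set.Icc (-R) R) : I * (ω : ℂ) ∈ halfDisc R := by
  refine ⟨by simp, ?_⟩
  simpa using abs_le.2 hω

theorem arc_re (R θ : ℝ) : ((R : ℂ) * exp (θ * I)).re = R * Real.cos θ := by
  rw [re_ofReal_mul, exp_ofReal_mul_I_re]

theorem arc_im (R θ : ℝ) : ((R : ℂ) * exp (θ * I)).im = R * Real.sin θ := by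
  rw [im_ofReal_mul, exp_ofReal_mul_I_im]

theorem norm_arc {R : ℝ} (hR : 0 ≤ R) (θ : ℝ) : ‖(R : ℂ) * exp (θ * I)‖ = R := by
  rw [norm_mul, norm_exp_ofReal_mul_I, mul_one, norm_real, Real.norm_of_nonneg hR]

theorem arc_mem_halfDisc {R θ : ℝ} (hR : 0 ≤ R)
    (hθ : θ ∈ Set.Icc (-(Real.pi / 2)) (Real.pi / 2)) :
    (R : ℂ) * exp (θ * I) ∈ halfDisc R :=
  ⟨by rw [arc_re]; exact mul_nonneg hR (Real.cos_nonneg_of_mem_Icc hθ), (norm_arc hR θ).le⟩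

theorem hasDerivAt_arc (R θ : ℝ) :
    HasDerivAt (fun θ : ℝ => (R : ℂ) * exp (θ * I)) (R * exp (θ * I) * I) θ := by
  have h : HasDerivAt (fun θ : ℝ => (θ : ℂ) * I) (1 * I) θ :=
    (hasDerivAt_id θ).ofReal_comp.mul_const I
  simpa [mul_assoc] using (h.cexp.const_mul (R : ℂ))

theorem hasDerivAt_axis (ω : ℝ) : HasDerivAt (fun ω : ℝ => I * (ω : ℂ)) I ω := by
  simpa using (hasDerivAt_id ω).ofReal_comp.const_mul I

theorem arc_pi_div_two (R : ℝ) : (R : ℂ) * exp ((Real.pi / 2 : ℝ) * I) = I * R := by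
  have : ((Real.pi / 2 : ℝ) : ℂ) * I = Real.pi / 2 * I := by push_cast; ring
  rw [this, exp_pi_div_two_mul_I, mul_comm]

theorem arc_neg_pi_div_two (R : ℝ) :
    (R : ℂ) * exp ((-(Real.pi / 2) : ℝ) * I) = I * ((-R : ℝ) : ℂ) := by
  have : ((-(Real.pi / 2) : ℝ) : ℂ) * I = -Real.pi / 2 * I := by push_cast; ring
  rw [this, exp_neg_pi_div_two_mul_I]
  push_cast; ring

/-- The semicircle is parametrized injectively: a point is reached at its argument only. -/
theorem eq_arg_of_arc_eq {R θ : ℝ} (hR : 0 < R)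
    (hθ : θ ∈ Set.Icc (-(Real.pi / 2)) (Real.pi / 2)) {z : ℂ}
    (h : (R : ℂ) * exp (θ * I) = z) : θ = z.arg := by
  have hpi := Real.pi_pos
  rw [← h, exp_mul_I, arg_mul_cos_add_sin_mul_I hR ⟨by linarith [hθ.1], by linarith [hθ.2]⟩]

theorem finite_preimage_arc {R : ℝ} (hR : 0 < R) {Z : Set ℂ} (hZ : Z.Finite) :
    {θ : ℝ | θ ∈ Set.Icc (-(Real.pi / 2)) (Real.pi / 2) ∧ (R : ℂ) * exp (θ * I) ∈ Z}.Finite :=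
  (hZ.image arg).subset fun _ hθ => ⟨_, hθ.2, (eq_arg_of_arc_eq hR hθ.1 rfl).symm⟩

theorem finite_preimage_axis {Z : Set ℂ} (hZ : Z.Finite) : {ω : ℝ | I * (ω : ℂ) ∈ Z}.Finite :=
  (hZ.image im).subset fun ω hω => ⟨_, hω, by simp⟩

/-- Finitely many exceptional points do not matter for contour integrals. -/
theorem HasContourIntegral.congr {R : ℝ} (hR : 0 < R) {f₁ f₂ : ℂ → ℂ} {v : ℂ} {Z : Set ℂ}
    (hZ : Z.Finite) (h : HasContourIntegral R f₁ v)
    (he : ∀ s ∈ halfDisc R, s ∉ Z → f₁ s = f₂ s) : HasContourIntegral R f₂ v := by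
  have h1 : ∀ᵐ ω : ℝ, ω ∈ Set.uIoc (-R) R → f₁ (I * ω) = f₂ (I * ω) := by
    filter_upwards [MeasureTheory.compl_mem_ae_iff.2
      ((finite_preimage_axis hZ).measure_zero MeasureTheory.volume)] with ω hω hωR
    rw [Set.uIoc_of_le (by linarith)] at hωR
    exact he _ (I_mul_mem_halfDisc ⟨hωR.1.le, hωR.2⟩) hω
  have h2 : ∀ᵐ θ : ℝ, θ ∈ Set.uIoc (-(Real.pi / 2)) (Real.pi / 2) →
      f₁ (R * exp (θ * I)) * (R * exp (θ * I) * I) =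
        f₂ (R * exp (θ * I)) * (R * exp (θ * I) * I) := by
    filter_upwards [MeasureTheory.compl_mem_ae_iff.2
      ((finite_preimage_arc hR hZ).measure_zero MeasureTheory.volume)] with θ hθ hθR
    rw [Set.uIoc_of_le (by linarith [Real.pi_pos])] at hθR
    have hθ' := Set.Ioc_subset_Icc_self hθR
    rw [he _ (arc_mem_halfDisc hR.le hθ') fun hz => hθ ⟨hθ', hz⟩]
  refine ⟨h.1.congr_ae ((MeasureTheory.ae_restrict_iff' measurableSet_uIoc).2 h1),
    h.2.1.congr_ae ((MeasureTheory.ae_restrict_iff' measurableSet_uIoc).2 h2), ?_⟩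
  rw [← h.2.2, arcIntegral, arcIntegral, intervalIntegral.integral_congr_ae h1,
    intervalIntegral.integral_congr_ae h2]

/-! ### The contour integral of a logarithm -/

/-- The cut to the left from a point `p` enclosed by the semicircle does not cross the semicircle;
with the roles exchanged, the cut to the right from a point outside does not enter the half-disc. -/
theorem sub_mem_slitPlane_of_norm_le {s p : ℂ} (hs : 0 ≤ s.re)
    (h : ‖p‖ ≤ ‖s‖) : s - p ∈ slitPlane ∨ s - p = 0 := by
  by_cases him : s.im = p.im
  · have h2 := mul_self_le_mul_self (norm_nonneg p) h
    rw [norm_mul_self_eq_normSq, norm_mul_self_eq_normSq, normSq_apply, normSq_apply, him] at h2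
    have hre : p.re ≤ s.re := by nlinarith
    rcases hre.eq_or_lt with hre | hre
    · exact Or.inr (sub_eq_zero.2 (Complex.ext hre.symm him))
    · exact Or.inl (Or.inl (by simpa using hre))
  · exact Or.inl (Or.inr (by simpa [sub_eq_zero] using him))

/-- With the opposite branch, `w * log w` changes by a multiple of `w`. -/
theorem mul_log_sub_neg {w : ℂ} (hw : 0 < w.im ∨ w = 0) :
    w * log w + -w * log (-w) = Real.pi * I * w := by
  rcases hw with hw | rfl
  · rw [log_eq_log_neg_add hw]; ring
  · simp

/-- The contour integral of `log (s - p)`, whose cut goes from `p` to the left, is `-2πi` times the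
length of the part of the cut inside the half-disc.  That length is at most `re p`, and equal to
it if the half-disc contains `p`. -/
theorem exists_hasContourIntegral_log {R : ℝ} (hR : 0 < R) {p : ℂ} (hp : 0 ≤ p.re) :
    ∃ len : ℝ, 0 ≤ len ∧ len ≤ p.re ∧ (‖p‖ ≤ R → len = p.re) ∧
      HasContourIntegral R (fun s => log (s - p)) (-(2 * Real.pi * I * len)) := by
  have hpi := Real.pi_pos
  have aax : ∀ t : ℝ, AnalyticAt ℝ (fun ω : ℝ => I * (ω : ℂ) - p) t := fun t =>
    (analyticAt_const.mul (ofRealCLM.analyticAt t)).sub analyticAt_const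
  have aarc : ∀ t : ℝ, AnalyticAt ℝ (fun θ : ℝ => (R : ℂ) * exp (θ * I) - p) t := fun t =>
    (analyticAt_const.mul (analyticAt_cexp.restrictScalars.comp
      (f := fun θ : ℝ => (θ : ℂ) * I)
      ((ofRealCLM.analyticAt t).mul analyticAt_const))).sub analyticAt_const
  have iax : IntervalIntegrable (fun ω : ℝ => log (I * ω - p)) MeasureTheory.volume (-R) R :=
    intervalIntegrable_log_comp (fun t => aax t) _ _
  have iarc : IntervalIntegrable
      (fun θ : ℝ => log (R * exp (θ * I) - p) * (R * exp (θ * I) * I))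
      MeasureTheory.volume (-(Real.pi / 2)) (Real.pi / 2) :=
    (intervalIntegrable_log_comp (γ := fun θ : ℝ => R * exp (θ * I) - p)
      (fun t => aarc t) _ _).mul_continuousOn (by fun_prop)
  have iax' : ∀ x y, IntervalIntegrable (fun ω : ℝ => log (-(I * ω - p)) * I)
      MeasureTheory.volume x y := fun x y =>
    (intervalIntegrable_log_comp (γ := fun ω : ℝ => -(I * ω - p))
      (fun t => (aax t).neg) _ _).mul_const I
  have iarc' : ∀ x y, IntervalIntegrable
      (fun θ : ℝ => log (-(R * exp (θ * I) - p)) * (R * exp (θ * I) * I))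
      MeasureTheory.volume x y := fun x y =>
    (intervalIntegrable_log_comp (γ := fun θ : ℝ => -(R * exp (θ * I) - p))
      (fun t => (aarc t).neg) _ _).mul_continuousOn (by fun_prop)
  have dax : ∀ ω : ℝ, HasDerivAt (fun ω : ℝ => I * (ω : ℂ) - p) I ω := fun ω =>
    (hasDerivAt_axis ω).sub_const p
  have darc : ∀ θ : ℝ, HasDerivAt (fun θ : ℝ => R * exp (θ * I) - p) (R * exp (θ * I) * I) θ :=
    fun θ => (hasDerivAt_arc R θ).sub_const p
  have carc : Continuous fun θ : ℝ => (R : ℂ) * exp (θ * I) * I := by fun_prop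
  -- with the cut to the right, `log` has its antiderivative along the axis
  have hax : ∫ ω in (-R)..R, log (-(I * (ω : ℂ) - p)) * I =
      -((-(I * R - p) * log (-(I * R - p)) - -(I * R - p)) -
        (-(I * (-R : ℝ) - p) * log (-(I * (-R : ℝ) - p)) - -(I * (-R : ℝ) - p))) := by
    rw [← integral_log_mul_deriv (γ := fun ω : ℝ => -(I * (ω : ℂ) - p)) (γ' := fun _ => -I)
      (s := {p.im}) (by linarith) (Set.countable_singleton _) (fun t => (dax t).neg) ?_ ?_ ?_,
      ← intervalIntegral.integral_neg]
    · simp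
    · intro ω _
      by_cases hω : ω = p.im
      · rcases hp.eq_or_lt with h | h
        · exact Or.inr (by apply Complex.ext <;> simp [hω, ← h])
        · exact Or.inl (Or.inl (by simpa using h))
      · exact Or.inl (Or.inr (by simpa [sub_eq_zero, eq_comm] using hω))
    · intro ω hω h0
      refine hω.2 ?_
      have := congrArg im h0
      simp only [neg_im, sub_im, mul_im, I_re, I_im, ofReal_re, ofReal_im, zero_im] at this
      simp only [Set.mem_singleton_iff]; linarith
    · simp only [mul_neg]; exact (iax' (-R) R).neg
  have hI : ∀ f : ℝ → ℂ, I * ∫ ω in (-R)..R, f ω = ∫ ω in (-R)..R, f ω * I := fun f => by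
    rw [intervalIntegral.integral_mul_const, mul_comm]
  by_cases hpR : ‖p‖ ≤ R
  · -- the pole is enclosed: the cut crosses the axis, at the height of `p`, but not the arc
    refine ⟨p.re, hp, le_rfl, fun _ => rfl, iax, iarc, ?_⟩
    have him := abs_le.1 ((abs_im_le_norm p).trans hpR)
    have harc := integral_log_mul_deriv (γ := fun θ : ℝ => R * exp (θ * I) - p)
      (s := {p.arg}) (a := -(Real.pi / 2)) (b := Real.pi / 2) (by linarith)
      (Set.countable_singleton _) darc
      (fun θ hθ => sub_mem_slitPlane_of_norm_le (arc_mem_halfDisc hR.le hθ).1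
        (by rwa [norm_arc hR.le]))
      (fun θ hθ h0 => hθ.2 (eq_arg_of_arc_eq hR (Set.Ioo_subset_Icc_self hθ.1) (sub_eq_zero.1 h0)))
      iarc
    have hcr := integral_log_mul_deriv_of_crossing (γ := fun ω : ℝ => I * (ω : ℂ) - p)
      (γ' := fun _ => I) (a := -R) (b := R) (c := p.im) him dax continuous_const
      (fun t ht => by simpa using ht.2) (fun t ht => by simpa using ht.1) iax'
    have hc0 : I * (p.im : ℂ) - p = -p.re := by apply Complex.ext <;> simp
    have e1 : (I * R - p) * log (I * R - p) + -(I * R - p) * log (-(I * R - p)) =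
        Real.pi * I * (I * R - p) := by
      refine mul_log_sub_neg ?_
      rcases him.2.eq_or_lt with h | h
      · right
        have h2 := mul_self_le_mul_self (norm_nonneg p) hpR
        rw [norm_mul_self_eq_normSq, normSq_apply, h] at h2
        have : p.re = 0 := by nlinarith
        apply Complex.ext <;> simp [this, h]
      · left; simpa using h
    have e2 : -(I * (-R : ℝ) - p) * log (-(I * (-R : ℝ) - p)) +
        -(-(I * (-R : ℝ) - p)) * log (-(-(I * (-R : ℝ) - p))) =
        Real.pi * I * -(I * (-R : ℝ) - p) := by
      refine mul_log_sub_neg ?_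
      rcases him.1.eq_or_lt with h | h
      · right
        have h2 := mul_self_le_mul_self (norm_nonneg p) hpR
        rw [norm_mul_self_eq_normSq, normSq_apply, ← h] at h2
        have : p.re = 0 := by nlinarith
        apply Complex.ext <;> simp [this, ← h]
      · left; simp; linarith
    rw [neg_neg] at e2
    rw [hI, arcIntegral, harc, hcr, hax, hc0, arc_pi_div_two, arc_neg_pi_div_two]
    push_cast at e1 e2 ⊢
    linear_combination e1 - e2
  · -- the pole is not enclosed: the cut crosses the axis and the arc at equal heights, or neither
    push Not at hpR
    set c := Real.arcsin (p.im / R) with hc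
    have hcI := Real.arcsin_mem_Icc (p.im / R)
    have hcos : 0 ≤ R * Real.cos c := mul_nonneg hR.le (Real.cos_nonneg_of_mem_Icc hcI)
    have hlt : ∀ θ ∈ Set.Ico (-(Real.pi / 2)) c, R * Real.sin θ < p.im := fun θ hθ => by
      have := (Real.lt_arcsin_iff_sin_lt' ⟨hθ.1, hθ.2.trans_le hcI.2⟩).1 hθ.2
      rwa [lt_div_iff₀ hR, mul_comm] at this
    have hgt : ∀ θ ∈ Set.Ioc c (Real.pi / 2), p.im < R * Real.sin θ := fun θ hθ => by
      have := (Real.arcsin_lt_iff_lt_sin' ⟨hcI.1.trans_lt hθ.1, hθ.2⟩).1 hθ.1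
      rwa [div_lt_iff₀ hR, mul_comm] at this
    have hc' : R * Real.sin c ∈ Set.Icc (-R) R := by
      constructor <;> nlinarith [Real.neg_one_le_sin c, Real.sin_le_one c]
    have hcrossing_arc := integral_log_mul_deriv_of_crossing
      (γ := fun θ : ℝ => R * exp (θ * I) - p) hcI darc carc
      (fun θ hθ => by
        rw [sub_im, arc_im]; exact sub_neg.2 (hlt θ hθ))
      (fun θ hθ => by
        rw [sub_im, arc_im]; exact sub_pos.2 (hgt θ hθ)) iarc'
    -- `R * sin c` is `p.im`, clamped to `[-R, R]`
    have hclamp : R * Real.sin c = max (-R) (min R p.im) := by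
      rcases le_total p.im (-R) with h | h
      · rw [hc, Real.arcsin_of_le_neg_one (by rw [div_le_iff₀ hR]; linarith), Real.sin_neg,
          Real.sin_pi_div_two, min_eq_right (by linarith), max_eq_left h]
        ring
      rcases le_total R p.im with h' | h'
      · rw [hc, Real.arcsin_of_one_le (by rw [le_div_iff₀ hR]; linarith),
          Real.sin_pi_div_two, min_eq_left h', max_eq_right (by linarith), mul_one]
      · rw [hc, Real.sin_arcsin (by rw [le_div_iff₀ hR]; linarith)
          (by rw [div_le_iff₀ hR]; linarith), min_eq_right h', max_eq_right h,
          mul_div_cancel₀ _ hR.ne']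
    have hcrossing_ax := integral_log_mul_deriv_of_crossing
      (γ := fun ω : ℝ => I * (ω : ℂ) - p) (γ' := fun _ => I) hc' dax continuous_const
      (fun t ht => by
        have h1 := ht.2
        rw [hclamp] at h1
        have : ¬ t < -R := not_lt.2 ht.1
        simp only [lt_max_iff, lt_min_iff, this, false_or] at h1
        simpa using h1.2)
      (fun t ht => by
        have h1 := ht.1
        rw [hclamp] at h1
        have : ¬ R < t := not_lt.2 ht.2
        simp only [max_lt_iff, min_lt_iff, this, false_or] at h1
        simpa using h1.2) iax'
    have hlog := integral_log_mul_deriv (γ := fun θ : ℝ => -(R * exp (θ * I) - p))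
      (γ' := fun θ => -(R * exp (θ * I) * I))
      (s := ∅) (a := -(Real.pi / 2)) (b := Real.pi / 2) (by linarith)
      Set.countable_empty (fun θ => (darc θ).neg)
      (fun θ hθ => by
        rw [neg_sub]
        exact sub_mem_slitPlane_of_norm_le hp (by rw [norm_arc hR.le]; exact hpR.le))
      (fun θ hθ h0 => by
        rw [neg_sub, sub_eq_zero] at h0
        rw [h0, norm_arc hR.le] at hpR
        exact lt_irrefl _ hpR)
      (by simp only [mul_neg]; exact (iarc' _ _).neg)
    simp only [mul_neg, intervalIntegral.integral_neg] at hlog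
    refine ⟨R * Real.cos c, hcos, ?_, fun h => absurd h (not_le.2 hpR), iax, iarc, ?_⟩
    · have hsc := Real.sin_sq_add_cos_sq c
      have hp2 := mul_self_lt_mul_self hR.le hpR
      rw [norm_mul_self_eq_normSq, normSq_apply] at hp2
      refine abs_le_of_sq_le_sq' ?_ hp |>.2
      rcases le_total p.im (-R) with h | h
      · rw [max_eq_left ((min_le_right _ _).trans h)] at hclamp
        nlinarith [sq_nonneg p.re]
      rcases le_total R p.im with h' | h'
      · rw [min_eq_left h', max_eq_right (by linarith)] at hclamp
        nlinarith [sq_nonneg p.re]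
      · rw [min_eq_right h', max_eq_right h] at hclamp
        nlinarith
    · rw [hI, arcIntegral, hcrossing_arc, hcrossing_ax, hax, neg_eq_iff_eq_neg.1 hlog,
        arc_pi_div_two, arc_neg_pi_div_two, exp_mul_I, ← ofReal_cos, ← ofReal_sin]
      push_cast
      ring

/-! ### Cauchy's theorem for the half-disc -/

theorem convex_halfDisc (R : ℝ) : Convex ℝ (halfDisc R) := by
  have h : halfDisc R = {s : ℂ | 0 ≤ s.re} ∩ Metric.closedBall 0 R := by
    ext s; simp [halfDisc]
  rw [h]
  exact (convex_halfSpace_re_ge 0).inter (convex_closedBall 0 R)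

theorem isCompact_halfDisc (R : ℝ) : IsCompact (halfDisc R) := by
  have h : halfDisc R = Metric.closedBall 0 R ∩ {s : ℂ | 0 ≤ s.re} := by
    ext s; simp [halfDisc, and_comm]
  rw [h]
  exact (isCompact_closedBall 0 R).inter_right (isClosed_le continuous_const continuous_re)

/-- Cauchy's theorem for the half-disc, for functions differentiable up to the boundary. -/
theorem hasContourIntegral_zero_of_differentiableOn {R : ℝ} (hR : 0 < R) {f : ℂ → ℂ}
    (hf : DifferentiableOn ℂ f (halfDisc R)) : HasContourIntegral R f 0 := by
  obtain ⟨Φ, hΦ⟩ := (convex_halfDisc R).exists_forall_hasDerivWithinAt hf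
  have hpi := Real.pi_pos
  have cax : ContinuousOn (fun ω : ℝ => f (I * ω)) (Set.uIcc (-R) R) := by
    rw [Set.uIcc_of_le (by linarith)]
    exact hf.continuousOn.comp (by fun_prop) fun ω hω => I_mul_mem_halfDisc hω
  have carc : ContinuousOn (fun θ : ℝ => f (R * exp (θ * I)) * (R * exp (θ * I) * I))
      (Set.uIcc (-(Real.pi / 2)) (Real.pi / 2)) := by
    rw [Set.uIcc_of_le (by linarith)]
    exact (hf.continuousOn.comp (by fun_prop) fun θ hθ => arc_mem_halfDisc hR.le hθ).mul
      (by fun_prop)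
  refine ⟨cax.intervalIntegrable, carc.intervalIntegrable, ?_⟩
  have cΦ : ContinuousOn Φ (halfDisc R) := fun s hs => (hΦ s hs).continuousWithinAt
  have key : ∀ {γ γ' : ℝ → ℂ} {a b : ℝ}, a ≤ b → (∀ t, HasDerivAt γ (γ' t) t) →
      (∀ t ∈ Set.Icc a b, γ t ∈ halfDisc R) →
      IntervalIntegrable (fun t => f (γ t) * γ' t) MeasureTheory.volume a b →
      ∫ t in a..b, f (γ t) * γ' t = Φ (γ b) - Φ (γ a) := by
    intro γ γ' a b hab hd hm hi
    refine intervalIntegral.integral_eq_sub_of_hasDerivAt_of_le hab (f := Φ ∘ γ)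
      (cΦ.comp (fun t _ => (hd t).continuousAt.continuousWithinAt) hm) (fun t ht => ?_) hi
    have hd' : HasDerivWithinAt γ (γ' t) (Set.Icc a b) t := (hd t).hasDerivWithinAt
    have := HasDerivWithinAt.comp t (hΦ (γ t) (hm t (Set.Ioo_subset_Icc_self ht))) hd'
      (fun x hx => hm x hx)
    exact this.hasDerivAt (Icc_mem_nhds ht.1 ht.2)
  have h1 := key (by linarith) (hasDerivAt_arc R) (fun θ hθ => arc_mem_halfDisc hR.le hθ)
    carc.intervalIntegrable
  have h2 := key (by linarith) hasDerivAt_axis (fun ω hω => I_mul_mem_halfDisc hω)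
    (cax.intervalIntegrable.mul_const I)
  rw [intervalIntegral.integral_mul_const] at h2
  rw [arcIntegral, h1, mul_comm I, h2, arc_pi_div_two, arc_neg_pi_div_two]
  ring

/-- Cauchy's theorem for the half-disc, for bounded functions that are continuous up to the
boundary with finitely many exceptions. -/
theorem hasContourIntegral_zero_of_bounded {R : ℝ} (hR : 0 < R) {k : ℂ → ℂ} {Z : Set ℂ}
    (hZ : Z.Finite) (hZ0 : ∀ z ∈ Z, z.re = 0)
    (hd : DifferentiableOn ℂ k {s | s ∈ openRHP ∧ ‖s‖ < R})
    (hc : ContinuousOn k (halfDisc R \ Z)) {C : ℝ} (hC : ∀ s ∈ halfDisc R \ Z, ‖k s‖ ≤ C) :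
    HasContourIntegral R k 0 := by
  have hpi := Real.pi_pos
  -- contractions towards `R / 2` map the half-disc into its interior
  let φ : ℝ → ℂ → ℂ := fun ρ s => (1 - ρ : ℝ) * (R / 2 : ℝ) + ρ * s
  have hφ : ∀ ρ ∈ Set.Ioo (0 : ℝ) 1, ∀ s ∈ halfDisc R, 0 < (φ ρ s).re ∧ ‖φ ρ s‖ < R := by
    intro ρ hρ s hs
    constructor
    · have e : (φ ρ s).re = (1 - ρ) * (R / 2) + ρ * s.re := by
        simp only [φ, add_re, re_ofReal_mul, ofReal_re]
      rw [e]
      have := mul_pos (sub_pos.2 hρ.2) (half_pos hR)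
      have := mul_nonneg hρ.1.le hs.1
      linarith
    · have h1 : ‖φ ρ s‖ ≤ (1 - ρ) * (R / 2) + ρ * ‖s‖ := by
        refine (norm_add_le _ _).trans_eq ?_
        rw [norm_mul, norm_mul, norm_real, norm_real, norm_real,
          Real.norm_of_nonneg (sub_pos.2 hρ.2).le, Real.norm_of_nonneg (half_pos hR).le,
          Real.norm_of_nonneg hρ.1.le]
      have := mul_pos (sub_pos.2 hρ.2) (half_pos hR)
      have := mul_le_mul_of_nonneg_left hs.2 hρ.1.le
      nlinarith
  have hmem : ∀ ρ ∈ Set.Ioo (0 : ℝ) 1, ∀ s ∈ halfDisc R, φ ρ s ∈ halfDisc R \ Z :=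
    fun ρ hρ s hs => ⟨⟨(hφ ρ hρ s hs).1.le, (hφ ρ hρ s hs).2.le⟩,
      fun hz => (hφ ρ hρ s hs).1.ne' (hZ0 _ hz)⟩
  have hev : ∀ᶠ ρ in 𝓝[<] (1 : ℝ), ρ ∈ Set.Ioo (0 : ℝ) 1 :=
    Ioo_mem_nhdsLT one_pos
  have h0 : ∀ ρ ∈ Set.Ioo (0 : ℝ) 1, HasContourIntegral R (fun s => k (φ ρ s)) 0 := by
    intro ρ hρ
    refine hasContourIntegral_zero_of_differentiableOn hR ?_
    exact hd.comp (by fun_prop) fun s hs => hφ ρ hρ s hs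
  have hlim : ∀ s ∈ halfDisc R \ Z, Tendsto (fun ρ => k (φ ρ s)) (𝓝[<] 1) (𝓝 (k s)) := by
    intro s hs
    have h1 : Tendsto (fun ρ => φ ρ s) (𝓝[<] 1) (𝓝 s) := by
      have hcφ : Continuous fun ρ => φ ρ s := by fun_prop
      have := hcφ.tendsto 1
      simp only [φ, sub_self, ofReal_zero, zero_mul, ofReal_one, one_mul, zero_add] at this
      exact this.mono_left nhdsWithin_le_nhds
    refine (hc s hs).tendsto.comp (tendsto_nhdsWithin_iff.2 ⟨h1, ?_⟩)
    filter_upwards [hev] with ρ hρ using hmem ρ hρ s hs.1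
  have lim : ∀ {a b : ℝ} {γ w : ℝ → ℂ}, a ≤ b → Continuous w →
      (∀ t ∈ Set.Icc a b, γ t ∈ halfDisc R) → {t | t ∈ Set.Icc a b ∧ γ t ∈ Z}.Finite →
      (∀ ρ ∈ Set.Ioo (0 : ℝ) 1,
        IntervalIntegrable (fun t => k (φ ρ (γ t)) * w t) MeasureTheory.volume a b) →
      IntervalIntegrable (fun t => k (γ t) * w t) MeasureTheory.volume a b ∧
      Tendsto (fun ρ => ∫ t in a..b, k (φ ρ (γ t)) * w t) (𝓝[<] 1)
        (𝓝 (∫ t in a..b, k (γ t) * w t)) := by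
    intro a b γ w hab hw hγ hfin hint
    have hne : ∀ᵐ t : ℝ, t ∈ Set.uIoc a b → γ t ∈ halfDisc R \ Z := by
      filter_upwards [MeasureTheory.compl_mem_ae_iff.2
        (hfin.measure_zero MeasureTheory.volume)] with t ht htab
      rw [Set.uIoc_of_le hab] at htab
      have htab' := Set.Ioc_subset_Icc_self htab
      exact ⟨hγ t htab', fun hz => ht ⟨htab', hz⟩⟩
    have hsub : ∀ t ∈ Set.uIoc a b, γ t ∈ halfDisc R := fun t ht => by
      rw [Set.uIoc_of_le hab] at ht
      exact hγ t (Set.Ioc_subset_Icc_self ht)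
    have hmeas : ∀ᶠ ρ in 𝓝[<] (1 : ℝ), MeasureTheory.AEStronglyMeasurable
        (fun t => k (φ ρ (γ t)) * w t) (MeasureTheory.volume.restrict (Set.uIoc a b)) := by
      filter_upwards [hev] with ρ hρ
      exact (hint ρ hρ).def'.aestronglyMeasurable
    have hlim' : ∀ᵐ t : ℝ, t ∈ Set.uIoc a b →
        Tendsto (fun ρ => k (φ ρ (γ t)) * w t) (𝓝[<] 1) (𝓝 (k (γ t) * w t)) := by
      filter_upwards [hne] with t ht htab
      exact (hlim _ (ht htab)).mul_const _
    have hbi : IntervalIntegrable (fun t => C * ‖w t‖) MeasureTheory.volume a b :=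
      (hw.norm.const_mul C).intervalIntegrable a b
    refine ⟨?_, intervalIntegral.tendsto_integral_filter_of_dominated_convergence
      (fun t => C * ‖w t‖) hmeas ?_ hbi hlim'⟩
    · refine hbi.mono_fun ?_ ?_
      · exact aestronglyMeasurable_of_tendsto_ae (𝓝[<] (1 : ℝ)) (f := fun ρ t =>
          if ρ ∈ Set.Ioo (0 : ℝ) 1 then k (φ ρ (γ t)) * w t else 0)
          (fun ρ => by
            by_cases hρ : ρ ∈ Set.Ioo (0 : ℝ) 1
            · simp only [hρ, if_true]; exact (hint ρ hρ).def'.aestronglyMeasurable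
            · simp only [hρ, if_false]; exact MeasureTheory.aestronglyMeasurable_const)
          ((MeasureTheory.ae_restrict_iff' measurableSet_uIoc).2 (by
            filter_upwards [hlim'] with t ht htab
            refine (ht htab).congr' ?_
            filter_upwards [hev] with ρ hρ
            simp [hρ.1, hρ.2]))
      · refine (MeasureTheory.ae_restrict_iff' measurableSet_uIoc).2 ?_
        filter_upwards [hne] with t ht htab
        rw [norm_mul]
        exact (mul_le_mul_of_nonneg_right (hC _ (ht htab)) (norm_nonneg _)).trans (le_abs_self _)
    · filter_upwards [hev] with ρ hρ
      refine Eventually.of_forall fun t ht => ?_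
      rw [norm_mul]
      exact mul_le_mul_of_nonneg_right (hC _ (hmem ρ hρ _ (hsub t ht))) (norm_nonneg _)
  obtain ⟨i1, l1⟩ := lim (γ := fun θ : ℝ => R * exp (θ * I)) (w := fun θ => R * exp (θ * I) * I)
    (a := -(Real.pi / 2)) (b := Real.pi / 2) (by linarith) (by fun_prop)
    (fun θ hθ => arc_mem_halfDisc hR.le hθ) (finite_preimage_arc hR hZ)
    (fun ρ hρ => (h0 ρ hρ).2.1)
  obtain ⟨i2, l2⟩ := lim (γ := fun ω : ℝ => I * ω) (w := fun _ => 1)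
    (a := -R) (b := R) (by linarith) (by fun_prop)
    (fun ω hω => I_mul_mem_halfDisc hω) ((finite_preimage_axis hZ).subset fun _ h => h.2)
    (fun ρ hρ => (h0 ρ hρ).1.mul_const 1)
  simp only [mul_one] at i2 l2
  refine ⟨i2, i1, tendsto_nhds_unique (l1.sub (l2.const_mul I)) ?_⟩
  refine tendsto_const_nhds.congr' ?_
  filter_upwards [hev] with ρ hρ using (h0 ρ hρ).2.2.symm

/-! ### Boundedness of logarithms -/

/-- A continuous function on a connected set is bounded if its exponential stays near a nonzero
constant. -/
theorem exists_norm_le_of_exp_near_const {W : Set ℂ} (hW : IsPreconnected W) {k : ℂ → ℂ}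
    (hk : ContinuousOn k W) {c : ℂ} (hc : c ≠ 0)
    (h : ∀ s ∈ W, ‖exp (k s) / c - 1‖ ≤ 1 / 2) : ∃ C, ∀ s ∈ W, ‖k s‖ ≤ C := by
  rcases W.eq_empty_or_nonempty with rfl | ⟨s₀, hs₀⟩
  · exact ⟨0, by simp⟩
  let φ : ℂ → ℂ := fun s => k s - log (exp (k s) / c)
  have hslit : ∀ s ∈ W, exp (k s) / c ∈ slitPlane := fun s hs => by
    refine Or.inl ?_
    have := (abs_le.1 ((abs_re_le_norm _).trans (h s hs))).1
    rw [sub_re, one_re] at this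
    linarith
  have hφ : ContinuousOn φ W := hk.sub ((hk.cexp.div_const c).clog hslit)
  have hexp : ∀ s ∈ W, exp (φ s) = c := fun s hs => by
    rw [exp_sub, exp_log (slitPlane_ne_zero (hslit s hs)), div_div_cancel₀ (exp_ne_zero _)]
  -- logarithms of `c` form a countable set, so a connected set of them is a single point
  have hcount : {w : ℂ | exp w = c}.Countable := by
    refine (Set.countable_range fun n : ℤ => log c + n * (2 * Real.pi * I)).mono fun w hw => ?_
    have hw' : exp w = exp (log c) := by rw [exp_log hc]; exact hw
    obtain ⟨n, hn⟩ := exp_eq_exp_iff_exists_int.1 hw'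
    exact ⟨n, hn.symm⟩
  have hconst : ∀ s ∈ W, φ s = φ s₀ := fun s hs =>
    hcount.isTotallyDisconnected (φ '' W) (Set.image_subset_iff.2 hexp) (hW.image φ hφ)
      ⟨s, hs, rfl⟩ ⟨s₀, hs₀, rfl⟩
  refine ⟨‖φ s₀‖ + 1, fun s hs => ?_⟩
  have e : k s = φ s + log (1 + (exp (k s) / c - 1)) := by simp [φ]
  rw [e, hconst s hs]
  refine (norm_add_le _ _).trans (add_le_add_right ?_ _)
  have := norm_log_one_add_half_le_self (h s hs)
  linarith [h s hs]

/-- On the horizontal line through `p` the principal logarithm is continuous from above, so this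
line may belong to the part of the plane above `p`. -/
theorem continuousOn_log_sub {W : Set ℂ} {p : ℂ} (hp : ∀ s ∈ W, s ≠ p)
    (h : (∀ s ∈ W, s.im < p.im) ∨ ∀ s ∈ W, p.im ≤ s.im) :
    ContinuousOn (fun s => log (s - p)) W := by
  rcases h with h | h
  · exact (continuousOn_id.sub continuousOn_const).clog fun s hs =>
      Or.inr (by simpa [sub_eq_zero] using (h s hs).ne)
  · intro s hs
    by_cases hslit : s - p ∈ slitPlane
    · exact (continuousWithinAt_id.sub continuousWithinAt_const).clog hslit
    · rw [mem_slitPlane_iff, not_or, not_lt, not_not] at hslit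
      have hre : (s - p).re < 0 := hslit.1.lt_of_ne fun h0 =>
        hp s hs (sub_eq_zero.1 (Complex.ext h0 hslit.2))
      exact (continuousWithinAt_log_of_re_neg_of_im_zero hre hslit.2).comp
        (t := {z : ℂ | 0 ≤ z.im}) (f := fun s => s - p)
        (continuousWithinAt_id.sub continuousWithinAt_const)
        (fun w hw => by simpa using h w hw)

theorem isBigO_log_sub {z p : ℂ} (h : z ≠ p) :
    (fun s => log (s - p)) =O[𝓝 z] (fun _ => (1 : ℝ)) := by
  have hlog : ContinuousAt (fun s : ℂ => |Real.log ‖s - p‖| + Real.pi) z :=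
    ((((continuousAt_id.sub continuousAt_const).norm).log
      (norm_ne_zero_iff.2 (sub_ne_zero.2 h))).abs).add continuousAt_const
  refine Asymptotics.IsBigO.trans (.of_norm_le fun s => ?_) (hlog.tendsto.isBigO_one ℝ)
  refine (norm_le_abs_re_add_abs_im _).trans ?_
  rw [log_re, log_im]
  exact add_le_add_right (abs_arg_le_pi _) _

/-! ### The regular part of a branch of the logarithm of the sensitivity -/

section LogBranch

variable {S g : ℂ → ℂ} {p : ℕ → ℂ} {d : ℕ → ℝ}

/-- Every point of the closed right half-plane, on the imaginary axis too, has points of the open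
half-plane nearby, where `g` has no zeros. -/
theorem WeierstrassFactorization.not_eventually_eq_zero (hS : WeierstrassFactorization S g p d)
    {z : ℂ} (hz : 0 ≤ z.re) : ¬ ∀ᶠ s in 𝓝 z, g s = 0 := by
  intro h
  obtain ⟨r, hr, hball⟩ := Metric.eventually_nhds_iff.1 h
  refine hS.ne_zero (z + (r / 2 : ℝ)) ?_ (hball ?_)
  · simp only [openRHP, Set.mem_ofPred_eq, add_re, ofReal_re]; linarith
  · rw [dist_eq_norm, add_sub_cancel_left, norm_real, Real.norm_of_nonneg (by linarith)]
    linarith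

theorem WeierstrassFactorization.finite_zeros (hS : WeierstrassFactorization S g p d) (R : ℝ) :
    {s | s ∈ halfDisc R ∧ g s = 0}.Finite := by
  by_contra hinf
  obtain ⟨z, hz, hacc⟩ := Set.Infinite.exists_accPt_of_subset_isCompact hinf
    (isCompact_halfDisc R) fun s hs => hs.1
  refine hS.not_eventually_eq_zero hz.1 ?_
  rw [← (hS.analytic z hz.1).frequently_zero_iff_eventually_zero]
  exact (accPt_iff_frequently_nhdsNE.1 hacc).mono fun s hs => hs.2

theorem finite_poles (hp_lim : ∀ z : ℂ, ¬ AccPt z (𝓟 (Set.range p))) (R : ℝ) :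
    {s | s ∈ halfDisc R ∧ s ∈ Set.range p}.Finite := by
  by_contra hinf
  obtain ⟨z, _, hacc⟩ := Set.Infinite.exists_accPt_of_subset_isCompact hinf
    (isCompact_halfDisc R) fun s hs => hs.1
  exact hp_lim z (hacc.mono (principal_mono.2 fun s hs => hs.2))

/-- Near a point without poles, a partial product approximates the infinite product to within a
small relative error, because the limit does not vanish. -/
theorem exists_partial_product_near {T : ℂ → ℂ} {q : ℕ → Polynomial ℂ}
    (hT : TendstoLocallyUniformlyOn (fun (N : ℕ) (s : ℂ) =>
        ∏ j ∈ Finset.range N, ((s - p j) ^ (d j : ℂ) * exp ((q j).eval s))) T atTop closedRHP)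
    (hd : ∀ j, 0 < d j) {z : ℂ} (hz : z ∈ closedRHP) (hTz : T z ≠ 0) :
    ∃ N, ∀ᶠ s in 𝓝[closedRHP] z, ‖T s /
      ∏ j ∈ Finset.range N, ((s - p j) ^ (d j : ℂ) * exp ((q j).eval s)) - 1‖ ≤ 1 / 8 := by
  set ε := ‖T z‖ / 16 with hε
  have hTz' : 0 < ‖T z‖ := norm_pos_iff.2 hTz
  obtain ⟨t, ht, hN⟩ := Metric.tendstoLocallyUniformlyOn_iff.1 hT ε (by positivity) z hz
  obtain ⟨N, hN⟩ := hN.exists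
  refine ⟨N, ?_⟩
  have hcont : Continuous fun s => ‖∏ j ∈ Finset.range N,
      ((s - p j) ^ (d j : ℂ) * exp ((q j).eval s))‖ := by
    simp only [norm_prod, norm_mul, norm_cpow_real]
    refine continuous_finsetProd _ fun j _ => ?_
    refine ((continuous_id.sub continuous_const).norm.rpow_const fun s => Or.inr (hd j).le).mul ?_
    exact (continuous_exp.comp (q j).continuous).norm
  have hz' : 14 * ε < ‖∏ j ∈ Finset.range N,
      ((z - p j) ^ (d j : ℂ) * exp ((q j).eval z))‖ := by
    have h1 := hN z (mem_of_mem_nhdsWithin hz ht)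
    rw [dist_eq_norm] at h1
    have := norm_sub_norm_le (T z)
      (∏ j ∈ Finset.range N, ((z - p j) ^ (d j : ℂ) * exp ((q j).eval z)))
    linarith
  filter_upwards [ht, nhdsWithin_le_nhds (hcont.continuousAt.eventually (lt_mem_nhds hz'))]
    with s hs hPs
  have h1 := hN s hs
  rw [dist_eq_norm] at h1
  have hP0 := norm_pos_iff.1 ((by positivity : (0 : ℝ) < 14 * ε).trans hPs)
  rw [div_sub_one hP0, norm_div, div_le_iff₀ (norm_pos_iff.2 hP0)]
  linarith

/-- The regular part `h` of a branch of `log S` has at most logarithmic singularities on the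
imaginary axis: at a zero of `g` of order `m`, it is `m * log (s - z)` up to a bounded function. -/
theorem exists_local_bound (hS : WeierstrassFactorization S g p d)
    (hp_re : ∀ j, 0 < (p j).re) (hp_lim : ∀ z : ℂ, ¬ AccPt z (𝓟 (Set.range p)))
    (hd : ∀ j, 0 < d j) {R : ℝ} {F : Finset ℕ} {h : ℂ → ℂ}
    (hc : ContinuousOn h {s | s ∈ closedRHP ∧ ‖s‖ ≤ R ∧ g s ≠ 0})
    (hexp : ∀ s ∈ closedRHP, ‖s‖ ≤ R → s ∉ singularSet g p →
      exp (h s + ∑ j ∈ F, (d j : ℂ) * log (s - p j)) = S s) {z : ℂ} (hz : z.re = 0) :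
    ∃ (m : ℕ) (C : ℝ), ∀ᶠ s in 𝓝 z, s ∈ halfDisc R → s ≠ z → ‖h s - m * log (s - z)‖ ≤ C := by
  obtain ⟨q, T, hT, hT0, hST⟩ := hS.factor
  have hzR : z ∈ closedRHP := hz.ge
  have hzp : ∀ j, z ≠ p j := fun j hj => (hp_re j).ne' (by rw [← hj, hz])
  obtain ⟨m, G, hG, hGz, hgG⟩ :=
    (hS.analytic z hzR).exists_eventuallyEq_pow_smul_nonzero_iff.2
      (hS.not_eventually_eq_zero hzR)
  obtain ⟨N, hN⟩ := exists_partial_product_near hT hd hzR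
    (hT0 z hzR (by rintro ⟨j, hj⟩; exact hzp j hj.symm))
  let P : ℂ → ℂ := fun s => ∏ j ∈ Finset.range N, ((s - p j) ^ (d j : ℂ) * exp ((q j).eval s))
  -- the difference of the logarithms split off in `h` and a logarithm of the partial product
  let E : ℂ → ℂ := fun s => ∑ j ∈ F, (d j : ℂ) * log (s - p j) -
    ∑ j ∈ Finset.range N, ((d j : ℂ) * log (s - p j) + (q j).eval s)
  have hE : E =O[𝓝 z] (fun _ => (1 : ℝ)) := by
    refine Asymptotics.IsBigO.sub (.fun_sum fun j _ => (isBigO_log_sub (hzp j)).const_mul_left _)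
      (.fun_sum fun j _ => ((isBigO_log_sub (hzp j)).const_mul_left _).add ?_)
    exact (q j).continuous.continuousAt.tendsto.isBigO_one ℝ
  obtain ⟨CE, hCE⟩ := hE.bound
  have hGnear : ∀ᶠ s in 𝓝 z, ‖G s / G z - 1‖ < 1 / 8 := by
    have hcont : ContinuousAt (fun s => ‖G s / G z - 1‖) z :=
      ((hG.continuousAt.div_const _).sub continuousAt_const).norm
    refine hcont.eventually (gt_mem_nhds ?_)
    simp [hGz]
  have hpole : ∀ᶠ s in 𝓝 z, s ∉ Set.range p := by
    have := hp_lim z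
    rw [accPt_iff_frequently, not_frequently] at this
    filter_upwards [this] with s hs hsp
    by_cases hsz : s = z
    · obtain ⟨j, hj⟩ := hsp
      exact hzp j (by rw [hj, hsz])
    · exact hs ⟨hsz, hsp⟩
  have him : ∀ᶠ s in 𝓝 z, ∀ j ∈ F ∪ Finset.range N,
      ((p j).im < z.im → (p j).im < s.im) ∧ (z.im < (p j).im → s.im < (p j).im) := by
    rw [Filter.eventually_all_finset]
    intro j _
    refine .and ?_ ?_
    · by_cases hj : (p j).im < z.im
      · filter_upwards [continuous_im.continuousAt.eventually (lt_mem_nhds hj)] with s hs _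
          using hs
      · exact .of_forall fun s hs => absurd hs hj
    · by_cases hj : z.im < (p j).im
      · filter_upwards [continuous_im.continuousAt.eventually (gt_mem_nhds hj)] with s hs _
          using hs
      · exact .of_forall fun s hs => absurd hs hj
  obtain ⟨r, hr, hball⟩ := Metric.eventually_nhds_iff_ball.1
    (((((hgG.and (eventually_nhdsWithin_iff.1 hN)).and hCE).and hGnear).and hpole).and him)
  -- on a connected set avoiding the cuts, the remainder has a controlled exponential
  have key : ∀ W : Set ℂ, IsPreconnected W → W ⊆ halfDisc R → W ⊆ Metric.ball z r → z ∉ W →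
      (∀ j ∈ F ∪ Finset.range N, (∀ s ∈ W, s.im < (p j).im) ∨ ∀ s ∈ W, (p j).im ≤ s.im) →
      ∃ C, ∀ s ∈ W, ‖h s - m * log (s - z)‖ ≤ C := by
    intro W hW hWR hWr hzW hcut
    have hne : ∀ s ∈ W, s - z ≠ 0 := fun s hs h0 => hzW (by rwa [← sub_eq_zero.1 h0])
    have hG0 : ∀ s ∈ W, G s ≠ 0 := by
      intro s hs h0
      have := (hball s (hWr hs)).1.1.2
      rw [h0, zero_div, zero_sub, norm_neg, norm_one] at this
      norm_num at this
    have hg : ∀ s ∈ W, g s = (s - z) ^ m * G s := fun s hs => (hball s (hWr hs)).1.1.1.1.1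
    have hg0 : ∀ s ∈ W, g s ≠ 0 := fun s hs => by
      rw [hg s hs]; exact mul_ne_zero (pow_ne_zero _ (hne s hs)) (hG0 s hs)
    have hpW : ∀ s ∈ W, ∀ j, s ≠ p j := fun s hs j hj => (hball s (hWr hs)).1.2 ⟨j, hj.symm⟩
    have hlogp : ∀ j ∈ F ∪ Finset.range N, ContinuousOn (fun s => log (s - p j)) W :=
      fun j hj => continuousOn_log_sub (fun s hs => hpW s hs j) (hcut j hj)
    have hlogz : ContinuousOn (fun s => log (s - z)) W := by
      refine (continuousOn_id.sub continuousOn_const).clog fun s hs => ?_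
      by_cases h0 : s.im = z.im
      · refine Or.inl (lt_of_le_of_ne (by simpa [hz] using (hWR hs).1) fun h1 => ?_)
        exact hne s hs (Complex.ext h1.symm (by simp [h0]))
      · exact Or.inr (by simpa [sub_eq_zero] using h0)
    have hcE : ContinuousOn E W := by
      refine (continuousOn_finsetSum _ fun j hj => continuousOn_const.mul
        (hlogp j (Finset.mem_union_left _ hj))).sub
        (continuousOn_finsetSum _ fun j hj => (continuousOn_const.mul
          (hlogp j (Finset.mem_union_right _ hj))).add (q j).continuous.continuousOn)
    have hk : ContinuousOn (fun s => h s - m * log (s - z) + E s) W :=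
      ((hc.mono fun s hs => ⟨(hWR hs).1, (hWR hs).2, hg0 s hs⟩).sub
        (continuousOn_const.mul hlogz)).add hcE
    obtain ⟨C, hC⟩ := exists_norm_le_of_exp_near_const hW hk hGz fun s hs => by
      have hP : P s = exp (∑ j ∈ Finset.range N, ((d j : ℂ) * log (s - p j) + (q j).eval s)) := by
        rw [exp_sum]
        refine Finset.prod_congr rfl fun j _ => ?_
        rw [cpow_def_of_ne_zero (sub_ne_zero.2 (hpW s hs j)), exp_add, mul_comm (log _)]
      have hP0 : P s ≠ 0 := by rw [hP]; exact exp_ne_zero _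
      have hsing : s ∉ singularSet g p := by
        rintro (⟨j, hj⟩ | h0)
        · exact hpW s hs j hj.symm
        · exact hg0 s hs h0
      have e1 : exp (h s - m * log (s - z) + E s) = G s * (T s / P s) := by
        have e0 : h s - m * log (s - z) + E s =
            (h s + ∑ j ∈ F, (d j : ℂ) * log (s - p j)) - m * log (s - z) -
              ∑ j ∈ Finset.range N, ((d j : ℂ) * log (s - p j) + (q j).eval s) := by
          simp only [E]; ring
        rw [e0, exp_sub, exp_sub, hexp s (hWR hs).1 (hWR hs).2 hsing, ← hP, exp_nat_mul,
          exp_log (hne s hs), hST s (hWR hs).1 hsing, hg s hs]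
        field_simp [hne s hs, hP0]
      have b1 : ‖G s / G z - 1‖ ≤ 1 / 8 := (hball s (hWr hs)).1.1.2.le
      have b2 : ‖T s / P s - 1‖ ≤ 1 / 8 := (hball s (hWr hs)).1.1.1.1.2 (hWR hs).1
      have e2 : exp (h s - m * log (s - z) + E s) / G z - 1 =
          (G s / G z - 1) * (T s / P s - 1) + (G s / G z - 1) + (T s / P s - 1) := by
        rw [e1]; ring
      rw [e2]
      refine (norm_add₃_le).trans ?_
      rw [norm_mul]
      have := mul_le_mul b1 b2 (norm_nonneg _) (by norm_num)
      linarith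
    refine ⟨C + CE, fun s hs => ?_⟩
    have b : ‖E s‖ ≤ CE := by simpa using (hball s (hWr hs)).1.1.1.2
    have e : h s - m * log (s - z) = (h s - m * log (s - z) + E s) - E s := by ring
    rw [e]
    exact (norm_sub_le _ _).trans (add_le_add (hC s hs) b)
  have hconv := (convex_halfDisc R).inter (convex_ball z r)
  -- the point `z` is cut off by the last half-plane
  obtain ⟨C₁, hC₁⟩ := key ((halfDisc R ∩ Metric.ball z r) ∩
      ({s | z.im ≤ s.im} ∩ {s | z.im < s.re + s.im}))
    (hconv.inter ((convex_halfSpace_im_ge _).inter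
      (convex_halfSpace_gt (f := fun s : ℂ => s.re + s.im)
        ⟨fun x y => by simp only [add_re, add_im]; ring,
          fun c x => by simp only [real_smul, re_ofReal_mul, im_ofReal_mul, smul_eq_mul]; ring⟩ _)
      )).isPreconnected
    (fun s hs => hs.1.1) (fun s hs => hs.1.2)
    (fun hs => by have := hs.2.2; simp [hz] at this)
    (fun j hj => by
      rcases lt_or_ge z.im (p j).im with hlt | hge
      · exact Or.inl fun s hs => ((hball s hs.1.2).2 j hj).2 hlt
      · exact Or.inr fun s hs => hge.trans hs.2.1)
  obtain ⟨C₂, hC₂⟩ := key ((halfDisc R ∩ Metric.ball z r) ∩ {s | s.im < z.im})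
    (hconv.inter (convex_halfSpace_im_lt _)).isPreconnected
    (fun s hs => hs.1.1) (fun s hs => hs.1.2) (fun hs => lt_irrefl z.im hs.2)
    (fun j hj => by
      rcases lt_or_ge (p j).im z.im with hlt | hge
      · exact Or.inr fun s hs => (((hball s hs.1.2).2 j hj).1 hlt).le
      · exact Or.inl fun s hs => lt_of_lt_of_le hs.2 hge)
  refine ⟨m, max C₁ C₂, ?_⟩
  filter_upwards [Metric.ball_mem_nhds z hr] with s hsr hsR hsz
  rcases lt_or_ge s.im z.im with hlt | hge
  · exact (hC₂ s ⟨⟨hsR, hsr⟩, hlt⟩).trans (le_max_right _ _)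
  · refine (hC₁ s ⟨⟨hsR, hsr⟩, hge, ?_⟩).trans (le_max_left _ _)
    have h0 := hsR.1
    by_contra hle
    simp only [Set.mem_ofPred_eq, not_lt] at hle
    have hge' : z.im ≤ s.im := hge
    exact hsz (Complex.ext (by rw [hz]; linarith) (by linarith))

/-- The regular part of a branch of `log S` has contour integral zero. -/
theorem hasContourIntegral_regular_part (hS : WeierstrassFactorization S g p d)
    (hp_re : ∀ j, 0 < (p j).re) (hp_lim : ∀ z : ℂ, ¬ AccPt z (𝓟 (Set.range p)))
    (hd : ∀ j, 0 < d j) {R : ℝ} (hR : 0 < R) {F : Finset ℕ} {h : ℂ → ℂ}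
    (hdiff : DifferentiableOn ℂ h {s | s ∈ openRHP ∧ ‖s‖ < R})
    (hc : ContinuousOn h {s | s ∈ closedRHP ∧ ‖s‖ ≤ R ∧ g s ≠ 0})
    (hexp : ∀ s ∈ closedRHP, ‖s‖ ≤ R → s ∉ singularSet g p →
      exp (h s + ∑ j ∈ F, (d j : ℂ) * log (s - p j)) = S s) :
    HasContourIntegral R h 0 := by
  have hZ := hS.finite_zeros R
  set Z : Finset ℂ := hZ.toFinset with hZdef
  have hmem : ∀ s, s ∈ Z ↔ s ∈ halfDisc R ∧ g s = 0 := fun s => by simp [Z]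
  have hZre : ∀ z ∈ Z, z.re = 0 := fun z hz =>
    le_antisymm (not_lt.1 fun h0 => hS.ne_zero z h0 ((hmem z).1 hz).2) ((hmem z).1 hz).1.1
  choose! m C hC using fun (z : ℂ) (hz : z.re = 0) =>
    exists_local_bound hS hp_re hp_lim hd hc hexp hz
  let k : ℂ → ℂ := fun s => h s - ∑ z ∈ Z, (m z : ℂ) * log (s - z)
  have hslit : ∀ z ∈ Z, ∀ s : ℂ, 0 ≤ s.re → s ≠ z → s - z ∈ slitPlane := by
    intro z hz s hs hsz
    by_cases h0 : s.im = z.im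
    · refine Or.inl (lt_of_le_of_ne (by simpa [hZre z hz] using hs) fun h1 => ?_)
      exact hsz (sub_eq_zero.1 (Complex.ext h1.symm (by simp [h0])))
    · exact Or.inr (by simpa [sub_eq_zero] using h0)
  have kc : ContinuousOn k (halfDisc R \ Z) := by
    refine (hc.mono fun s hs => ⟨hs.1.1, hs.1.2, fun h0 => hs.2 ((hmem s).2 ⟨hs.1, h0⟩)⟩).sub
      (continuousOn_finsetSum _ fun z hz => continuousOn_const.mul ?_)
    exact (continuousOn_id.sub continuousOn_const).clog fun s hs =>
      hslit z hz s hs.1.1 fun h0 => hs.2 (h0 ▸ hz)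
  have kd : DifferentiableOn ℂ k {s | s ∈ openRHP ∧ ‖s‖ < R} := by
    refine hdiff.sub (DifferentiableOn.fun_sum fun z hz => DifferentiableOn.const_mul ?_ _)
    refine (differentiableOn_id.sub_const z).clog fun s hs => hslit z hz s (le_of_lt hs.1) ?_
    rintro rfl
    exact (hZre s hz).not_gt hs.1
  have kb : ∃ C, ∀ s ∈ halfDisc R, s ∈ halfDisc R \ Z → ‖k s‖ ≤ C := by
    refine (isCompact_halfDisc R).induction_on
      (p := fun t => ∃ C, ∀ s ∈ t, s ∈ halfDisc R \ Z → ‖k s‖ ≤ C)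
      ⟨0, by simp⟩ (fun t t' htt' ⟨C, hC⟩ => ⟨C, fun s hs => hC s (htt' hs)⟩)
      (fun t t' ⟨C, hC⟩ ⟨C', hC'⟩ => ⟨max C C', ?_⟩) (fun z hz => ?_)
    · rintro s (hs | hs) hsR
      · exact (hC s hs hsR).trans (le_max_left _ _)
      · exact (hC' s hs hsR).trans (le_max_right _ _)
    by_cases hzZ : z ∈ Z
    · have hO : (fun s => ∑ w ∈ Z.erase z, (m w : ℂ) * log (s - w)) =O[𝓝 z]
          (fun _ => (1 : ℝ)) :=
        .fun_sum fun w hw => (isBigO_log_sub (Finset.ne_of_mem_erase hw).symm).const_mul_left _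
      obtain ⟨B, hB⟩ := hO.bound
      refine ⟨_, mem_nhdsWithin_of_mem_nhds ((hC z (hZre z hzZ)).and hB), C z + B, ?_⟩
      rintro s ⟨h1, h2⟩ hs
      have e : k s = (h s - m z * log (s - z)) -
          ∑ w ∈ Z.erase z, (m w : ℂ) * log (s - w) := by
        simp only [k]
        rw [← Finset.add_sum_erase Z _ hzZ]; ring
      rw [e]
      refine (norm_sub_le _ _).trans (add_le_add (h1 hs.1 fun h0 => hs.2 (h0 ▸ hzZ)) ?_)
      simpa using h2
    · have hcz : ∀ᶠ s in 𝓝[halfDisc R \ Z] z, ‖k s‖ < ‖k z‖ + 1 :=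
        (kc z ⟨hz, hzZ⟩).norm.eventually (gt_mem_nhds (lt_add_one _))
      exact ⟨_, mem_nhdsWithin_of_mem_nhds (eventually_nhdsWithin_iff.1 hcz), ‖k z‖ + 1,
        fun s hs hsR => (hs hsR).le⟩
  obtain ⟨B, hB⟩ := kb
  have h1 := hasContourIntegral_zero_of_bounded hR Z.finite_toSet hZre kd kc
    fun s hs => hB s hs.1 hs
  have h2 : HasContourIntegral R (fun s => ∑ z ∈ Z, (m z : ℂ) * log (s - z))
      (∑ z ∈ Z, (m z : ℂ) * 0) := by
    refine .sum Z fun z hz => .const_mul _ ?_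
    obtain ⟨len, h0, hle, _, hlen⟩ := exists_hasContourIntegral_log hR (hZre z hz).ge
    have : len = 0 := le_antisymm (hle.trans_eq (hZre z hz)) h0
    simpa [this] using hlen
  simpa [k] using h1.add h2

/-- The contour integral of a branch of `log S` counts the poles: each contributes the length of
its branch cut inside the half-disc. -/
theorem IsLogBranch.exists_hasContourIntegral (hS : WeierstrassFactorization S g p d)
    (hp_re : ∀ j, 0 < (p j).re) (hp_lim : ∀ z : ℂ, ¬ AccPt z (𝓟 (Set.range p)))
    (hd : ∀ j, 0 < d j) {R : ℝ} (hR : 0 < R) {l : ℂ → ℂ} (hl : IsLogBranch S g p d R l) :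
    ∃ (F : Finset ℕ) (len : ℕ → ℝ), (∀ j, 0 ≤ len j ∧ len j ≤ (p j).re) ∧
      (∀ j, ‖p j‖ ≤ R → j ∈ F ∧ len j = (p j).re) ∧
      HasContourIntegral R l (-(2 * Real.pi * I * (∑ j ∈ F, d j * len j : ℝ))) := by
  obtain ⟨F, h, hF, hdiff, hc, hbr⟩ := hl
  choose len h0 hle heq hint using fun j => exists_hasContourIntegral_log hR (hp_re j).le
  refine ⟨F, len, fun j => ⟨h0 j, hle j⟩, fun j hj => ⟨hF j hj, heq j hj⟩, ?_⟩
  have h1 := hasContourIntegral_regular_part hS hp_re hp_lim hd hR hdiff hc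
    fun s hs hsR hsing => by rw [← (hbr s hs hsR hsing).1]; exact (hbr s hs hsR hsing).2
  have h2 := h1.add (HasContourIntegral.sum F fun j _ => (hint j).const_mul (d j : ℂ))
  have h3 := h2.congr hR ((finite_poles hp_lim R).union (hS.finite_zeros R)) (f₂ := l) ?_
  · convert h3 using 1
    push_cast
    rw [zero_add, Finset.mul_sum, ← Finset.sum_neg_distrib]
    exact Finset.sum_congr rfl fun j _ => by ring
  · intro s hs hsing
    refine ((hbr s hs.1 hs.2 ?_).1).symm
    rintro (h' | h')
    · exact hsing (Or.inl ⟨hs, h'⟩)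
    · exact hsing (Or.inr ⟨hs, h'⟩)

/-! ### The Bode integral -/

/-- For a branch of `log S`, the real part on the imaginary axis is half the Bode integrand. -/
theorem IsLogBranch.bodeIntegrand_ae_eq (hS : WeierstrassFactorization S g p d)
    (hp_lim : ∀ z : ℂ, ¬ AccPt z (𝓟 (Set.range p))) {R : ℝ} (hR : 0 < R) {l : ℂ → ℂ}
    (hl : IsLogBranch S g p d R l) :
    ∀ᵐ ω : ℝ, ω ∈ Set.uIoc (-R) R → 2 * (l (I * ω)).re = bodeIntegrand S ω := by
  obtain ⟨F, h, _, _, _, hbr⟩ := hl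
  filter_upwards [MeasureTheory.compl_mem_ae_iff.2 ((finite_preimage_axis
    ((finite_poles hp_lim R).union (hS.finite_zeros R))).measure_zero MeasureTheory.volume)]
    with ω hω hωR
  rw [Set.uIoc_of_le (by linarith)] at hωR
  have hmem := I_mul_mem_halfDisc (Set.Ioc_subset_Icc_self hωR)
  have hsing : I * (ω : ℂ) ∉ singularSet g p := by
    rintro (h' | h')
    · exact hω (Or.inl ⟨hmem, h'⟩)
    · exact hω (Or.inr ⟨hmem, h'⟩)
  rw [bodeIntegrand, ← (hbr _ hmem.1 hmem.2 hsing).2, norm_exp, Real.log_pow, Real.log_exp]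
  norm_num

/-- Once the half-disc encloses the poles of a given finite set, the total `c R` of the cut lengths
counts their cuts in full. -/
theorem eventually_sum_le_of_enclosed {c : ℝ → ℝ}
    (hc : ∀ᶠ R in atTop, ∃ (F : Finset ℕ) (len : ℕ → ℝ),
      (∀ j, 0 ≤ len j ∧ len j ≤ (p j).re) ∧ (∀ j, ‖p j‖ ≤ R → j ∈ F ∧ len j = (p j).re) ∧
      c R = ∑ j ∈ F, d j * len j)
    (hd : ∀ j, 0 < d j) (s : Finset ℕ) :
    ∀ᶠ R in atTop, ∑ j ∈ s, d j * (p j).re ≤ c R := by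
  have hs : ∀ᶠ R : ℝ in atTop, ∀ j ∈ s, ‖p j‖ ≤ R :=
    (Filter.eventually_all_finset s).2 fun j _ => eventually_ge_atTop _
  filter_upwards [hc, hs] with R ⟨F, len, hlen, henc, hcR⟩ hsR
  rw [hcR, Finset.sum_congr rfl fun j hj => by rw [← (henc j (hsR j hj)).2]]
  exact Finset.sum_le_sum_of_subset_of_nonneg (fun j hj => (henc j (hsR j hj)).1)
    fun j _ _ => mul_nonneg (hd j).le (hlen j).1

/-- The cuts of poles that are not enclosed are no longer than the real parts of these poles, so
`c R` never exceeds the sum over all poles. -/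
theorem tendsto_cut_sum {c : ℝ → ℝ}
    (hc : ∀ᶠ R in atTop, ∃ (F : Finset ℕ) (len : ℕ → ℝ),
      (∀ j, 0 ≤ len j ∧ len j ≤ (p j).re) ∧ (∀ j, ‖p j‖ ≤ R → j ∈ F ∧ len j = (p j).re) ∧
      c R = ∑ j ∈ F, d j * len j)
    (hd : ∀ j, 0 < d j) (hsum : Summable fun j => d j * (p j).re) :
    Tendsto c atTop (𝓝 (∑' j, d j * (p j).re)) := by
  refine tendsto_order.2 ⟨fun b hb => ?_, fun b hb => ?_⟩
  · obtain ⟨s, hs⟩ := (hsum.hasSum.eventually (lt_mem_nhds hb)).exists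
    filter_upwards [eventually_sum_le_of_enclosed hc hd s] with R hR using hs.trans_le hR
  · filter_upwards [hc] with R ⟨F, len, hlen, _, hcR⟩
    refine lt_of_le_of_lt ?_ hb
    rw [hcR]
    refine (Finset.sum_le_sum fun j _ => mul_le_mul_of_nonneg_left (hlen j).2 (hd j).le).trans ?_
    exact hsum.sum_le_tsum F fun j _ => mul_nonneg (hd j).le ((hlen j).1.trans (hlen j).2)

theorem tendsto_cut_sum_atTop {c : ℝ → ℝ}
    (hc : ∀ᶠ R in atTop, ∃ (F : Finset ℕ) (len : ℕ → ℝ),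
      (∀ j, 0 ≤ len j ∧ len j ≤ (p j).re) ∧ (∀ j, ‖p j‖ ≤ R → j ∈ F ∧ len j = (p j).re) ∧
      c R = ∑ j ∈ F, d j * len j)
    (hd : ∀ j, 0 < d j) (hp_re : ∀ j, 0 < (p j).re)
    (hsum : ¬ Summable fun j => d j * (p j).re) : Tendsto c atTop atTop := by
  refine tendsto_atTop.2 fun b => ?_
  by_contra hb
  refine hsum (summable_of_sum_le (c := b) (fun j => (mul_pos (hd j) (hp_re j)).le) fun s => ?_)
  by_contra hs
  refine hb ?_
  filter_upwards [eventually_sum_le_of_enclosed hc hd s] with R hR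
  exact (not_le.1 hs).le.trans hR

end LogBranch

theorem theorem2
    (L g : ℂ → ℂ) (p : ℕ → ℂ) (d : ℕ → ℝ)
    (hp_inj : Function.Injective p)
    (hp_re : ∀ j, 0 < (p j).re)
    (hp_lim : ∀ z : ℂ, ¬ AccPt z (𝓟 (Set.range p)))
    (hd : ∀ j, 0 < d j)
    (hS : WeierstrassFactorization (sensitivity L) g p d)
    (l : ℝ → ℂ → ℂ)
    (hl : ∀ᶠ R : ℝ in atTop, IsLogBranch (sensitivity L) g p d R (l R))
    (harc : Tendsto (fun R : ℝ => arcIntegral (l R) R) atTop (𝓝 0)) :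
    -- the truncated integrals of `log |S(iω)|²` exist and tend to the (possibly infinite) sum
    (∀ R : ℝ, IntervalIntegrable (bodeIntegrand (sensitivity L)) MeasureTheory.volume (-R) R) ∧
    Tendsto (fun R : ℝ => ((∫ ω in (-R)..R, bodeIntegrand (sensitivity L) ω : ℝ) : EReal)) atTop
      (𝓝 ((ENNReal.ofReal (4 * Real.pi) * ∑' j, ENNReal.ofReal (d j * (p j).re) : ENNReal) :
        EReal)) ∧
    -- the form `2 ∫ log S(iω) dω` of the Bode integral
    (∀ᶠ R : ℝ in atTop,
      IntervalIntegrable (fun ω : ℝ => l R (I * (ω : ℂ))) MeasureTheory.volume (-R) R) ∧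
    Tendsto (fun R : ℝ => (truncatedBodeLog (l R) R).im) atTop (𝓝 0) ∧
    (Summable (fun j => d j * (p j).re) →
      Tendsto (fun R : ℝ => truncatedBodeLog (l R) R) atTop
        (𝓝 ((4 * Real.pi * ∑' j, d j * (p j).re : ℝ) : ℂ))) ∧
    -- the absolutely convergent case
    (MeasureTheory.Integrable (bodeIntegrand (sensitivity L)) MeasureTheory.volume →
      Summable (fun j => d j * (p j).re) ∧
      ∫ ω : ℝ, bodeIntegrand (sensitivity L) ω = 4 * Real.pi * ∑' j, d j * (p j).re) := by
  have hpi := Real.pi_pos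
  -- the weighted length of the branch cuts inside the half-disc
  let c : ℝ → ℝ := fun R =>
    ((truncatedBodeLog (l R) R + 2 * I * arcIntegral (l R) R) / (4 * Real.pi)).re
  have hmain : ∀ᶠ R : ℝ in atTop, 0 < R ∧ IsLogBranch (sensitivity L) g p d R (l R) ∧
      IntervalIntegrable (fun ω : ℝ => l R (I * (ω : ℂ))) MeasureTheory.volume (-R) R ∧
      truncatedBodeLog (l R) R = (4 * Real.pi * c R : ℝ) - 2 * I * arcIntegral (l R) R ∧
      ∃ (F : Finset ℕ) (len : ℕ → ℝ), (∀ j, 0 ≤ len j ∧ len j ≤ (p j).re) ∧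
        (∀ j, ‖p j‖ ≤ R → j ∈ F ∧ len j = (p j).re) ∧ c R = ∑ j ∈ F, d j * len j := by
    filter_upwards [hl, eventually_gt_atTop 0] with R hlR hR
    obtain ⟨F, len, hlen, henc, hint⟩ := hlR.exists_hasContourIntegral hS hp_re hp_lim hd hR
    have e : truncatedBodeLog (l R) R + 2 * I * arcIntegral (l R) R =
        (4 * Real.pi * ∑ j ∈ F, d j * len j : ℝ) := by
      have := hint.2.2
      rw [truncatedBodeLog]
      push_cast at this ⊢
      linear_combination 2 * I * this +
        (2 * (∫ ω in (-R)..R, l R (I * (ω : ℂ))) -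
          4 * Real.pi * ∑ j ∈ F, (d j : ℂ) * len j) * I_sq
    have hcR : c R = ∑ j ∈ F, d j * len j := by
      simp only [c]
      rw [e]
      have : ((4 * Real.pi * ∑ j ∈ F, d j * len j : ℝ) : ℂ) / (4 * Real.pi) =
          ((∑ j ∈ F, d j * len j : ℝ) : ℂ) := by
        have : (Real.pi : ℂ) ≠ 0 := ofReal_ne_zero.2 hpi.ne'
        push_cast
        field_simp
      rw [this, ofReal_re]
    exact ⟨hR, hlR, hint.1, by rw [hcR, ← e]; ring, F, len, hlen, henc, hcR⟩
  have hc := hmain.mono fun R h => h.2.2.2.2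
  have hae := hmain.mono fun R h => h.2.1.bodeIntegrand_ae_eq hS hp_lim h.1
  have hbode : ∀ᶠ R : ℝ in atTop,
      IntervalIntegrable (bodeIntegrand (sensitivity L)) MeasureTheory.volume (-R) R ∧
      ∫ ω in (-R)..R, bodeIntegrand (sensitivity L) ω = (truncatedBodeLog (l R) R).re := by
    filter_upwards [hmain, hae] with R hR haeR
    have hre : IntervalIntegrable (fun ω : ℝ => (l R (I * (ω : ℂ))).re)
        MeasureTheory.volume (-R) R := ⟨hR.2.2.1.1.re, hR.2.2.1.2.re⟩
    refine ⟨(hre.const_mul 2).congr_ae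
      ((MeasureTheory.ae_restrict_iff' measurableSet_uIoc).2 haeR), ?_⟩
    rw [← intervalIntegral.integral_congr_ae haeR, intervalIntegral.integral_const_mul,
      truncatedBodeLog]
    have hcomm : ∫ ω in (-R)..R, (l R (I * (ω : ℂ))).re = (∫ ω in (-R)..R, l R (I * (ω : ℂ))).re :=
      reCLM.intervalIntegral_comp_comm hR.2.2.1
    rw [hcomm, mul_re, re_ofNat, im_ofNat, zero_mul, sub_zero]
  have hlim : Tendsto (fun R => 2 * I * arcIntegral (l R) R) atTop (𝓝 0) := by
    simpa using harc.const_mul (2 * I)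
  have hcombine : ∀ᶠ R in atTop, ∫ ω in (-R)..R, bodeIntegrand (sensitivity L) ω =
      4 * Real.pi * c R - (2 * I * arcIntegral (l R) R).re := by
    filter_upwards [hmain, hbode] with R hR hb
    rw [hb.2, hR.2.2.2.1, sub_re, ofReal_re]
  have hlim_re : Tendsto (fun R => (2 * I * arcIntegral (l R) R).re) atTop (𝓝 0) := by
    simpa only [zero_re, Function.comp_def] using (continuous_re.tendsto 0).comp hlim
  have htop : (¬ Summable fun j => d j * (p j).re) →
      Tendsto (fun R => ∫ ω in (-R)..R, bodeIntegrand (sensitivity L) ω) atTop atTop := by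
    intro hsum
    have h1 := (tendsto_cut_sum_atTop hc hd hp_re hsum).const_mul_atTop
      (by positivity : 0 < 4 * Real.pi)
    refine (h1.atTop_add hlim_re.neg).congr' ?_
    filter_upwards [hcombine] with R hR
    rw [hR, sub_eq_add_neg]
  have hfin : (Summable fun j => d j * (p j).re) →
      Tendsto (fun R => ∫ ω in (-R)..R, bodeIntegrand (sensitivity L) ω) atTop
        (𝓝 (4 * Real.pi * ∑' j, d j * (p j).re)) := by
    intro hsum
    have h1 := ((tendsto_cut_sum hc hd hsum).const_mul (4 * Real.pi)).sub hlim_re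
    rw [sub_zero] at h1
    exact h1.congr' (hcombine.mono fun R hR => hR.symm)
  have hnn : ∀ j, 0 ≤ d j * (p j).re := fun j => (mul_pos (hd j) (hp_re j)).le
  refine ⟨fun R => ?_, ?_, hmain.mono fun R h => h.2.2.1, ?_, fun hsum => ?_, fun hi => ?_⟩
  · obtain ⟨R', h, hR'⟩ := (hbode.and (eventually_ge_atTop |R|)).exists
    refine h.1.mono_set ?_
    have := abs_le.1 hR'
    rw [Set.uIcc_subset_uIcc_iff_mem, Set.uIcc_of_le (by linarith [abs_nonneg R])]
    exact ⟨⟨by linarith, by linarith⟩, ⟨by linarith, by linarith⟩⟩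
  · by_cases hsum : Summable fun j => d j * (p j).re
    · rw [← ENNReal.ofReal_tsum_of_nonneg hnn hsum, ← ENNReal.ofReal_mul (by positivity),
        EReal.coe_ennreal_ofReal, max_eq_left (mul_nonneg (by positivity) (tsum_nonneg hnn))]
      exact (continuous_coe_real_ereal.tendsto _).comp (hfin hsum)
    · have : ∑' j, ENNReal.ofReal (d j * (p j).re) = ⊤ := by
        by_contra h
        exact hsum (by simpa [ENNReal.toReal_ofReal, hnn] using ENNReal.summable_toReal h)
      rw [this, ENNReal.mul_top (by simpa using hpi), EReal.coe_ennreal_top,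
        EReal.tendsto_coe_nhds_top_iff]
      exact htop hsum
  · have h1 : Tendsto (fun R => -(2 * I * arcIntegral (l R) R).im) atTop (𝓝 0) := by
      simpa only [zero_im, neg_zero, Function.comp_def] using
        ((continuous_im.tendsto 0).comp hlim).neg
    refine h1.congr' ?_
    filter_upwards [hmain] with R hR
    rw [hR.2.2.2.1, sub_im, ofReal_im, zero_sub]
  · have h1 := ((continuous_ofReal.tendsto _).comp
      ((tendsto_cut_sum hc hd hsum).const_mul (4 * Real.pi))).sub hlim
    rw [sub_zero] at h1
    refine h1.congr' ?_
    filter_upwards [hmain] with R hR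
    rw [hR.2.2.2.1]; rfl
  · have h1 := MeasureTheory.intervalIntegral_tendsto_integral hi tendsto_neg_atTop_atBot
      tendsto_id
    have hsum : Summable fun j => d j * (p j).re := by
      by_contra hsum
      exact not_tendsto_nhds_of_tendsto_atTop (htop hsum) _ h1
    exact ⟨hsum, tendsto_nhds_unique h1 (hfin hsum)⟩
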